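/- Let $E,A\in\mathbb{C}^{n\times n}$, $B\in\mathbb{C}^{n\times m}$, $C\in\mathbb{C}^{m\times n}$. The system $E\dot x=Ax+Bu,\ y=Cx$ is called port-Hamiltonian (with structure matrix $Q$) if there are $Q,J,R\in\mathbb{C}^{n\times n}$ and $G,P\in\mathbb{C}^{n\times m}$ with $$A=(J-R)Q,\quad B=G-P,\quad C=(G+P)^*Q,\quad Q^*E=E^*Q\ge 0,\quad Q^*JQ=-(Q^*JQ)^*,\quad Q^*RQ\ge 0,\quad Q^*P=0 .$$ A pair $(E,A)$ is regular if $\det(sE-A)\neq 0$ for some $s\in\mathbb{C}$, impulse-free if $\deg\det(sE-A)=\operatorname{rank}E$, and asymptotically stable if every $s\in\mathbb{C}$ with $\det(sE-A)=0$ satisfies $\operatorname{Re}s<0$. Suppose that the system $E\dot x=Ax+Bu,\ y=Cx$ is port-Hamiltonian. Then the following are equivalent. (a) For every integer $r$ with $$\operatorname{rank}\begin{bmatrix}E&B\end{bmatrix}-\operatorname{rank}B\le r\le\operatorname{rank}\begin{bmatrix}E&B\end{bmatrix}$$ there exist $K,F\in\mathbb{C}^{m\times m}$ such that the pair $(E+BFC,\,A-BKC)$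 is regular, impulse-free and asymptotically stable, $\operatorname{rank}(E+BFC)=r$, and the closed-loop system $(E+BFC)\dot x=(A-BKC)x+Bv,\ y=Cx$ is port-Hamiltonian. (b) $$\operatorname{rank}\begin{bmatrix}E&0&0\\A&E&B\\C&0&0\end{bmatrix}=n+\operatorname{rank}\begin{bmatrix}E&B\end{bmatrix},$$ and for all $s\in\mathbb{C}$ with $\operatorname{Re}s=0$, $$\operatorname{rank}\begin{bmatrix}sE-A&B\end{bmatrix}=\operatorname{rank}\begin{bmatrix}sE-A\\C\end{bmatrix}=n .$$ Moreover, for every structure matrix $Q$ of the given system, the same equivalence holds when in (a) the closed-loop system is required to be port-Hamiltonian with this same structure matrix $Q$. -/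

import Mathlib

open scoped Matrix ComplexOrder

namespace PHDescriptor

/-- The matrix pair `(E, A)` is regular: `det (s E - A) ≠ 0` for some complex `s`. -/
def IsRegular {n : ℕ} (E A : Matrix (Fin n) (Fin n) ℂ) : Prop :=
  ∃ s : ℂ, (s • E - A).det ≠ 0

/-- The characteristic polynomial `det (s E - A)` of the pair, as a polynomial in `s`. -/
noncomputable def charPoly {n : ℕ} (E A : Matrix (Fin n) (Fin n) ℂ) : Polynomial ℂ :=
  ((Polynomial.X : Polynomial ℂ) • E.map Polynomial.C - A.map Polynomial.C).det

/-- The matrix pair `(E, A)` is impulse-free: `deg (det (s E - A)) = rank E`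
(the degree of the zero polynomial is `⊥`, which is never equal to a rank). -/
def IsImpulseFree {n : ℕ} (E A : Matrix (Fin n) (Fin n) ℂ) : Prop :=
  (charPoly E A).degree = (E.rank : WithBot ℕ)

/-- The matrix pair `(E, A)` is asymptotically stable: every finite root of `det (s E - A)`
lies in the open left half plane. -/
def IsAsymptoticallyStable {n : ℕ} (E A : Matrix (Fin n) (Fin n) ℂ) : Prop :=
  ∀ s : ℂ, (s • E - A).det = 0 → s.re < 0

/-- The descriptor system `E x' = A x + B u`, `y = C x` is port-Hamiltonian with structure
matrix `Q`. -/
def IsPortHamiltonianWith {n m : ℕ} (Q E A : Matrix (Fin n) (Fin n) ℂ)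
    (B : Matrix (Fin n) (Fin m) ℂ) (C : Matrix (Fin m) (Fin n) ℂ) : Prop :=
  ∃ (J R : Matrix (Fin n) (Fin n) ℂ) (G P : Matrix (Fin n) (Fin m) ℂ),
    A = (J - R) * Q ∧ B = G - P ∧ C = (G + P)ᴴ * Q ∧
    Qᴴ * E = Eᴴ * Q ∧ (Qᴴ * E).PosSemidef ∧
    Qᴴ * J * Q = -(Qᴴ * J * Q)ᴴ ∧
    (Qᴴ * R * Q).PosSemidef ∧
    Qᴴ * P = 0

/-- The descriptor system `E x' = A x + B u`, `y = C x` is a port-Hamiltonian descriptor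
system: its coefficients admit a port-Hamiltonian representation for some `Q`. -/
def IsPortHamiltonian {n m : ℕ} (E A : Matrix (Fin n) (Fin n) ℂ)
    (B : Matrix (Fin n) (Fin m) ℂ) (C : Matrix (Fin m) (Fin n) ℂ) : Prop :=
  ∃ Q : Matrix (Fin n) (Fin n) ℂ, IsPortHamiltonianWith Q E A B C

/-- `rank [E 0 0; A E B; C 0 0] = n + rank [E B]`. -/
def BlockRankCondition {n m : ℕ} (E A : Matrix (Fin n) (Fin n) ℂ)
    (B : Matrix (Fin n) (Fin m) ℂ) (C : Matrix (Fin m) (Fin n) ℂ) : Prop :=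
  (Matrix.fromRows
      (Matrix.fromCols E
        (Matrix.fromCols (0 : Matrix (Fin n) (Fin n) ℂ) (0 : Matrix (Fin n) (Fin m) ℂ)))
      (Matrix.fromRows
        (Matrix.fromCols A (Matrix.fromCols E B))
        (Matrix.fromCols C
          (Matrix.fromCols (0 : Matrix (Fin m) (Fin n) ℂ) (0 : Matrix (Fin m) (Fin m) ℂ))))).rank
    = n + (Matrix.fromCols E B).rank

/-- `rank [sE - A, B] = rank [sE - A; C] = n` for all `s` on the imaginary axis. -/
def ImaginaryAxisRankCondition {n m : ℕ} (E A : Matrix (Fin n) (Fin n) ℂ)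
    (B : Matrix (Fin n) (Fin m) ℂ) (C : Matrix (Fin m) (Fin n) ℂ) : Prop :=
  ∀ s : ℂ, s.re = 0 →
    (Matrix.fromCols (s • E - A) B).rank = n ∧ (Matrix.fromRows (s • E - A) C).rank = n

end PHDescriptor

open PHDescriptor

/-!
Write `E' = E + B F C` and `A' = A - B K C`. If `L` is an inner inverse of `E`, then `1 - L E`
projects onto `ker E`, and multiplying `s E - A` on the right by `s (1 - L E) + L E`, whose
determinant is `s ^ (n - rank E)`, gives a pencil with leading coefficient `E - A (1 - L E)`. Hence
the pair is impulse-free iff `E x = 0` and `A x ∈ range E` force `x = 0`. The block rank condition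
says in the same way that `E x = 0`, `C x = 0` and `A x ∈ range [E B]` force `x = 0`.

Necessity only needs the feedback for the maximal `r`, where `range E' = range [E B]`; moreover
`s E' - A' = s E - A + B (s F + K) C`, whose invertibility gives the rank conditions on the
imaginary axis.

For sufficiency take `K = 1`. Since `Qᴴ B = Cᴴ`, the closed loop dissipates at least `‖C x‖²`, so
`C x = 0` for any `x` that violates impulse-freeness or is an eigenvector to an eigenvalue in the
closed right half plane (for positive real part the energy balance also gives `E x = 0`). On such
an `x` the feedback vanishes, and the conditions on the open loop apply.

The feedback `F` acts through `Qᴴ E' = M + N F Nᴴ` with `M = Qᴴ E` and `N = Qᴴ B`. The matrix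
`S = M + N Nᴴ` has the maximal rank `rank [M N]`, and `range N ⊆ range S`. So if `N W` has `k`
independent columns, then `N W = S U` for some `U`, and the Schur complement
`S - S U (Uᴴ S U)⁻¹ Uᴴ S = M + N (1 - W (Uᴴ S U)⁻¹ Wᴴ) Nᴴ` is positive semidefinite of rank
`rank S - k`.
-/

namespace PHDescriptor

open Matrix

section Rank

variable {K l m n : Type*} [Field K] [Fintype n]

theorem rank_eq_of_mulVec_eq_zero_iff {M : Matrix l n K} {N : Matrix m n K}
    (h : ∀ x, M *ᵥ x = 0 ↔ N *ᵥ x = 0) : M.rank = N.rank := by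
  have hker : LinearMap.ker M.mulVecLin = LinearMap.ker N.mulVecLin := Submodule.ext h
  have hM := M.mulVecLin.finrank_range_add_finrank_ker
  have hN := N.mulVecLin.finrank_range_add_finrank_ker
  rw [hker] at hM
  exact Nat.add_right_cancel (hM.trans hN.symm)

theorem rank_eq_card_iff_mulVec_eq_zero (M : Matrix l n K) :
    M.rank = Fintype.card n ↔ ∀ x, M *ᵥ x = 0 → x = 0 := by
  have hdim := M.mulVecLin.finrank_range_add_finrank_ker
  rw [Module.finrank_fintype_fun_eq_card] at hdim
  rw [← ker_mulVecLin_eq_bot_iff, ← Submodule.finrank_eq_zero (R := K), Matrix.rank]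
  omega

variable [Fintype m]

theorem mul_mulVec_eq_zero (M : Matrix l m K) {N : Matrix m n K} {x : n → K} (hx : N *ᵥ x = 0) :
    (M * N) *ᵥ x = 0 := by
  rw [← mulVec_mulVec, hx, mulVec_zero]

theorem range_mulVecLin_fromCols (M : Matrix l m K) (N : Matrix l n K) :
    LinearMap.range (fromCols M N).mulVecLin =
      LinearMap.range M.mulVecLin ⊔ LinearMap.range N.mulVecLin := by
  ext y
  simp only [Submodule.mem_sup, LinearMap.mem_range, mulVecLin_apply]
  constructor
  · rintro ⟨x, rfl⟩
    exact ⟨_, ⟨x ∘ Sum.inl, rfl⟩, _, ⟨x ∘ Sum.inr, rfl⟩, (fromCols_mulVec M N x).symm⟩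
  · rintro ⟨_, ⟨u, rfl⟩, _, ⟨v, rfl⟩, rfl⟩
    exact ⟨Sum.elim u v, fromCols_mulVec_sumElim M N u v⟩

theorem range_mulVecLin_add_mul_le (M : Matrix l n K) (N : Matrix l m K) (Z : Matrix m n K) :
    LinearMap.range (M + N * Z).mulVecLin ≤ LinearMap.range (fromCols M N).mulVecLin := by
  rw [range_mulVecLin_fromCols]
  rintro _ ⟨x, rfl⟩
  rw [mulVecLin_apply, add_mulVec, ← mulVec_mulVec]
  exact Submodule.add_mem_sup ⟨x, rfl⟩ ⟨Z *ᵥ x, rfl⟩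

theorem rank_fromCols_eq_card_add_iff (M : Matrix l m K) (N : Matrix l n K) :
    (fromCols M N).rank = Fintype.card m + N.rank ↔
      ∀ x, M *ᵥ x ∈ LinearMap.range N.mulVecLin → x = 0 := by
  have hdim : (fromCols M N).rank + Module.finrank K
      ↥(LinearMap.range M.mulVecLin ⊓ LinearMap.range N.mulVecLin) = M.rank + N.rank := by
    rw [Matrix.rank, range_mulVecLin_fromCols]
    exact Submodule.finrank_sup_add_finrank_inf_eq _ _
  have hsplit : (fromCols M N).rank = Fintype.card m + N.rank ↔ M.rank = Fintype.card m ∧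
      Module.finrank K ↥(LinearMap.range M.mulVecLin ⊓ LinearMap.range N.mulVecLin) = 0 := by
    have := M.rank_le_card_width
    omega
  rw [hsplit, rank_eq_card_iff_mulVec_eq_zero, Submodule.finrank_eq_zero, Submodule.eq_bot_iff]
  constructor
  · rintro ⟨hker, hinf⟩ x hx
    exact hker x (hinf _ ⟨⟨x, rfl⟩, hx⟩)
  · refine fun h => ⟨fun x hx => h x (hx ▸ Submodule.zero_mem _), ?_⟩
    rintro _ ⟨⟨x, rfl⟩, hx⟩
    rw [h x hx, map_zero]

theorem rank_fromCols_eq_card_of_det_add_mul_ne_zero [DecidableEq n] {M : Matrix n n K}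
    {N : Matrix n m K} (Z : Matrix m n K) (h : (M + N * Z).det ≠ 0) :
    (fromCols M N).rank = Fintype.card n :=
  le_antisymm (rank_le_card_height _) <|
    (rank_of_det_ne_zero h).symm.trans_le <|
      Submodule.finrank_mono (range_mulVecLin_add_mul_le M N Z)

theorem rank_fromRows_eq_card_of_det_add_mul_ne_zero [DecidableEq n] {M : Matrix n n K}
    {N : Matrix m n K} (Z : Matrix n m K) (h : (M + Z * N).det ≠ 0) :
    (fromRows M N).rank = Fintype.card n := by
  refine (rank_eq_card_iff_mulVec_eq_zero _).2 fun x hx => eq_zero_of_mulVec_eq_zero h ?_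
  obtain ⟨hM, hN⟩ : M *ᵥ x = 0 ∧ N *ᵥ x = 0 := by
    rwa [fromRows_mulVec, ← Sum.elim_zero_zero, Sum.elim_eq_iff] at hx
  rw [add_mulVec, ← mulVec_mulVec, hM, hN, mulVec_zero, add_zero]

theorem exists_mul_eq_of_range_mulVecLin_le {M : Matrix l m K} {N : Matrix l n K}
    (h : LinearMap.range N.mulVecLin ≤ LinearMap.range M.mulVecLin) :
    ∃ Z : Matrix m n K, M * Z = N := by
  classical
  choose z hz using fun j => h ⟨Pi.single j 1, rfl⟩
  refine ⟨(of z)ᵀ, ext_col fun j => (hz j).trans ?_⟩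
  rw [mulVecLin_apply, mulVec_single_one]

theorem exists_mulVec_mul_injective_of_le_rank {M : Matrix l n K} {k : ℕ} (hk : k ≤ M.rank) :
    ∃ W : Matrix n (Fin k) K, Function.Injective (M * W).mulVec := by
  obtain ⟨v, hv⟩ := exists_linearIndependent_of_le_finrank hk
  choose w hw using fun j => (v j).2
  refine ⟨(of w)ᵀ, mulVec_injective_iff.2 ?_⟩
  have hcol : (M * (of w)ᵀ).col = fun j => (v j : l → K) := funext hw
  rw [hcol]
  exact hv.map' _ (Submodule.ker_subtype _)

/-- Guttman's rank additivity, with `Y` in the role of the inclusion of the eliminated block and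
`X` in that of the projection onto it. -/
theorem rank_sub_mul_inv_mul_add_card [Fintype l] {k : Type*} [Fintype k] [DecidableEq k]
    (M : Matrix l n K) {X : Matrix k l K} {Y : Matrix n k K} (h : IsUnit (X * M * Y).det) :
    (M - M * Y * (X * M * Y)⁻¹ * X * M).rank + Fintype.card k = M.rank := by
  classical
  set N := M - M * Y * (X * M * Y)⁻¹ * X * M
  have hXN : X * N = 0 := by
    have : X * (M * Y * (X * M * Y)⁻¹ * X * M) = X * M * Y * (X * M * Y)⁻¹ * (X * M) := by
      simp only [Matrix.mul_assoc]
    rw [Matrix.mul_sub, this, mul_nonsing_inv _ h, Matrix.one_mul, sub_self]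
  have hindep : ∀ c, (M * Y) *ᵥ c ∈ LinearMap.range N.mulVecLin → c = 0 := by
    rintro c ⟨x, hx⟩
    refine eq_zero_of_mulVec_eq_zero h.ne_zero ?_
    rw [Matrix.mul_assoc, ← mulVec_mulVec, ← hx, mulVecLin_apply, mulVec_mulVec, hXN, zero_mulVec]
  suffices (fromCols (M * Y) N).rank = M.rank by
    rwa [(rank_fromCols_eq_card_add_iff _ _).2 hindep, add_comm] at this
  apply le_antisymm
  · have hle := rank_mul_le_left M (fromCols Y (1 - Y * (X * M * Y)⁻¹ * X * M))
    simpa only [N, mul_fromCols, Matrix.mul_sub, Matrix.mul_one, Matrix.mul_assoc] using hle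
  · have hle := rank_mul_le_left (fromCols (M * Y) N) (fromRows ((X * M * Y)⁻¹ * X * M) 1)
    rw [fromCols_mul_fromRows, Matrix.mul_one] at hle
    simpa only [N, Matrix.mul_assoc, add_sub_cancel] using hle

end Rank

section Pencil

open Polynomial

variable {K n : Type*} [Field K] [Fintype n] [DecidableEq n]

theorem exists_mul_mul_self_and_mul_eq_conj (E : Matrix n n K) :
    ∃ (L U : Matrix n n K) (e : n ≃ Fin E.rank ⊕ Fin (Fintype.card n - E.rank)),
      IsUnit U.det ∧ E * L * E = E ∧ L * E = U * (fromBlocks 1 0 0 0).submatrix e e * U⁻¹ := by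
  obtain ⟨V, U, e, hV, hU, hVEU⟩ := exists_rank_normal_form E
  rw [isUnit_iff_isUnit_det] at hU hV
  set D : Matrix n n K := (fromBlocks 1 0 0 0).submatrix e e with hD
  have hDD : D * D = D := by
    rw [hD, submatrix_mul_equiv, fromBlocks_multiply]
    simp
  have hLE : U * V * E = U * D * U⁻¹ := by
    rw [← hVEU]
    simp only [Matrix.mul_assoc, mul_nonsing_inv _ hU, Matrix.mul_one]
  have hE : E = V⁻¹ * D * U⁻¹ := by
    rw [← hVEU, Matrix.mul_assoc V, nonsing_inv_mul_cancel_left _ _ hV,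
      mul_nonsing_inv_cancel_right _ _ hU]
  refine ⟨U * V, U, e, hU, ?_, hLE⟩
  rw [Matrix.mul_assoc, hLE, hE, Matrix.mul_assoc U, Matrix.mul_assoc (V⁻¹ * D),
    nonsing_inv_mul_cancel_left _ _ hU, ← Matrix.mul_assoc, Matrix.mul_assoc V⁻¹, hDD]

theorem det_X_smul_one_sub_add_of_eq_conj {k l : Type*} [Finite k] [Fintype l] [DecidableEq k]
    {P U : Matrix n n K} (hU : IsUnit U.det) (e : n ≃ k ⊕ l)
    (hP : P = U * (fromBlocks 1 0 0 0).submatrix e e * U⁻¹) :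
    ((X : K[X]) • (1 - P).map C + P.map C).det = X ^ Fintype.card l := by
  classical
  have := Fintype.ofFinite k
  set D : Matrix n n K := (fromBlocks 1 0 0 0).submatrix e e with hD
  have h_one_sub_D : 1 - D = (fromBlocks 0 0 0 1).submatrix e e := by
    have : (1 : Matrix (k ⊕ l) (k ⊕ l) K) - fromBlocks 1 0 0 0 = fromBlocks 0 0 0 1 := by
      rw [← fromBlocks_one, sub_eq_iff_eq_add, fromBlocks_add]
      simp only [zero_add, add_zero]
    rw [hD, ← submatrix_one_equiv e, ← this]
    rfl
  have hblock : (X : K[X]) • (1 - D).map C + D.map C =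
      (fromBlocks 1 0 0 ((X : K[X]) • 1)).submatrix e e := by
    have : (X : K[X]) • (fromBlocks 0 0 0 1 : Matrix (k ⊕ l) (k ⊕ l) K).map C +
        (fromBlocks 1 0 0 0 : Matrix (k ⊕ l) (k ⊕ l) K).map C =
        fromBlocks 1 0 0 ((X : K[X]) • 1) := by
      rw [fromBlocks_map, fromBlocks_map, fromBlocks_smul, fromBlocks_add]
      simp
    rw [h_one_sub_D, hD, ← this]
    rfl
  have hconj : (X : K[X]) • (1 - P).map C + P.map C =
      U.map C * ((X : K[X]) • (1 - D).map C + D.map C) * U⁻¹.map C := by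
    have h_one_sub_P : 1 - P = U * (1 - D) * U⁻¹ := by
      rw [hP, Matrix.mul_sub, Matrix.sub_mul, Matrix.mul_one, mul_nonsing_inv _ hU]
    rw [h_one_sub_P, hP]
    simp only [Matrix.map_mul, Matrix.mul_add, Matrix.add_mul, Matrix.mul_smul, Matrix.smul_mul]
  have hdetU : (U.map (C : K →+* K[X])).det * (U⁻¹.map C).det = 1 := by
    rw [← det_mul, ← Matrix.map_mul, mul_nonsing_inv _ hU, Matrix.map_one _ C_0 C_1, det_one]
  rw [hconj, det_mul_right_comm, det_mul, det_mul, hdetU, one_mul, hblock,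
    det_submatrix_equiv_self, det_fromBlocks_zero₂₁, det_one, one_mul, det_smul, det_one, mul_one]

theorem det_pencil_mul_det_pencil {E L : Matrix n n K} (hL : E * L * E = E) (A : Matrix n n K) :
    ((X : K[X]) • E.map C - A.map C).det *
      ((X : K[X]) • (1 - L * E).map C + (L * E).map C).det =
    ((X : K[X]) • (E - A * (1 - L * E)).map C + (-(A * L * E)).map C).det := by
  have hEP : E.map (C : K →+* K[X]) * (1 - L * E).map C = 0 := by
    rw [← Matrix.map_mul, Matrix.mul_sub, ← Matrix.mul_assoc, hL, Matrix.mul_one, sub_self]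
    simp
  have hEL : E.map (C : K →+* K[X]) * (L * E).map C = E.map C := by
    rw [← Matrix.map_mul, ← Matrix.mul_assoc, hL]
  rw [← det_mul, Matrix.sub_mul, Matrix.mul_add, Matrix.mul_add, Matrix.mul_smul, Matrix.smul_mul,
    Matrix.smul_mul, hEP, hEL, Matrix.mul_smul, ← Matrix.map_mul, ← Matrix.map_mul, smul_zero,
    smul_zero, zero_add, Matrix.map_sub _ (map_sub C), Matrix.map_neg _ (map_neg C), smul_sub,
    Matrix.mul_assoc]
  congr 1
  abel

theorem det_sub_mul_ne_zero_iff {E L : Matrix n n K} (hL : E * L * E = E) (A : Matrix n n K) :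
    (E - A * (1 - L * E)).det ≠ 0 ↔
      ∀ x, E *ᵥ x = 0 → A *ᵥ x ∈ LinearMap.range E.mulVecLin → x = 0 := by
  have hEP : E * (1 - L * E) = 0 := by
    rw [Matrix.mul_sub, ← Matrix.mul_assoc, hL, Matrix.mul_one, sub_self]
  constructor
  · rintro h x hx ⟨y, hy⟩
    set z := x + (L * E) *ᵥ y with hz_def
    have hPz : (1 - L * E) *ᵥ z = x := by
      rw [hz_def, mulVec_add, mulVec_mulVec, Matrix.sub_mul, Matrix.one_mul, Matrix.mul_assoc L E,
        ← Matrix.mul_assoc E L, hL, sub_self, zero_mulVec, add_zero, sub_mulVec, one_mulVec,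
        ← mulVec_mulVec, hx, mulVec_zero, sub_zero]
    have hEz : E *ᵥ z = A *ᵥ x := by
      rw [hz_def, mulVec_add, hx, zero_add, mulVec_mulVec, ← Matrix.mul_assoc, hL, ← hy,
        mulVecLin_apply]
    have hz : z = 0 := eq_zero_of_mulVec_eq_zero h <| by
      rw [sub_mulVec, ← mulVec_mulVec, hPz, hEz, sub_self]
    rw [← hPz, hz, mulVec_zero]
  · intro h hdet
    obtain ⟨z, hz0, hz⟩ := exists_mulVec_eq_zero_iff.2 hdet
    rw [sub_mulVec, ← mulVec_mulVec, sub_eq_zero] at hz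
    have hPz : (1 - L * E) *ᵥ z = 0 :=
      h _ (by rw [mulVec_mulVec, hEP, zero_mulVec]) ⟨z, hz⟩
    rw [hPz, mulVec_zero] at hz
    rw [sub_mulVec, one_mulVec, ← mulVec_mulVec, hz, mulVec_zero, sub_zero] at hPz
    exact hz0 hPz

theorem degree_det_pencil_eq_rank_iff (E A : Matrix n n K) :
    ((X : K[X]) • E.map C - A.map C).det.degree = E.rank ↔
      ∀ x, E *ᵥ x = 0 → A *ᵥ x ∈ LinearMap.range E.mulVecLin → x = 0 := by
  obtain ⟨L, U, e, hU, hL, hLE⟩ := exists_mul_mul_self_and_mul_eq_conj E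
  set p := ((X : K[X]) • E.map C - A.map C).det with hp
  have hmul := det_pencil_mul_det_pencil hL A
  rw [← hp, det_X_smul_one_sub_add_of_eq_conj hU e hLE, Fintype.card_fin] at hmul
  have hcard : E.rank + (Fintype.card n - E.rank) = Fintype.card n :=
    Nat.add_sub_cancel' E.rank_le_card_width
  have hcoeff : p.coeff E.rank = (E - A * (1 - L * E)).det := by
    rw [← coeff_det_X_add_C_card, ← hmul,
      ← coeff_mul_X_pow p (Fintype.card n - E.rank), hcard]
  have hdeg : p.degree ≤ E.rank := by
    refine degree_le_of_natDegree_le ?_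
    rcases eq_or_ne p 0 with h0 | h0
    · simp [h0]
    · have hle := natDegree_det_X_add_C_le (E - A * (1 - L * E)) (-(A * L * E))
      rw [← hmul, natDegree_mul_X_pow _ h0] at hle
      omega
  rw [← det_sub_mul_ne_zero_iff hL, ← hcoeff]
  refine ⟨fun h => ?_, fun h => hdeg.antisymm (le_degree_of_ne_zero h)⟩
  exact coeff_ne_zero_of_eq_degree h

end Pencil

section PosSemidef

variable {𝕜 m n : Type*} [RCLike 𝕜] [Fintype m] [Fintype n]

theorem posSemidef_sub_mul_inv_mul [DecidableEq m] {M : Matrix n n 𝕜} (hM : M.PosSemidef)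
    {U : Matrix n m 𝕜} (hU : (Uᴴ * M * U).PosDef) :
    (M - M * U * (Uᴴ * M * U)⁻¹ * Uᴴ * M).PosSemidef := by
  classical
  have hblock : (fromCols U 1)ᴴ * M * fromCols U 1 =
      fromBlocks (Uᴴ * M * U) (Uᴴ * M) (Uᴴ * M)ᴴ M := by
    rw [conjTranspose_fromCols_eq_fromRows_conjTranspose, fromRows_mul, fromRows_mul_fromCols]
    simp [hM.isHermitian.eq]
  have := hU.isUnit.invertible
  have hschur := (PosDef.fromBlocks₁₁ (Uᴴ * M) M hU).1
    (hblock ▸ hM.conjTranspose_mul_mul_same (fromCols U 1))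
  simpa [hM.isHermitian.eq, Matrix.mul_assoc] using hschur

theorem posDef_conjTranspose_mul_mul_of_injective {M : Matrix n n 𝕜} (hM : M.PosSemidef)
    {U : Matrix n m 𝕜} (hU : Function.Injective (M * U).mulVec) : (Uᴴ * M * U).PosDef := by
  have hUMU := hM.conjTranspose_mul_mul_same U
  refine .of_dotProduct_mulVec_pos hUMU.isHermitian fun x hx => ?_
  refine (hUMU.dotProduct_mulVec_nonneg x).lt_of_ne' fun h0 => hx (hU ?_)
  have hquad : star (U *ᵥ x) ⬝ᵥ M *ᵥ (U *ᵥ x) = 0 := by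
    rw [← h0, star_mulVec, ← dotProduct_mulVec, mulVec_mulVec, mulVec_mulVec, Matrix.mul_assoc]
  rw [← mulVec_mulVec, (hM.dotProduct_mulVec_zero_iff _).1 hquad, mulVec_zero]

theorem add_mulVec_eq_zero_iff_of_posSemidef {M N : Matrix n n 𝕜} (hM : M.PosSemidef)
    (hN : N.PosSemidef) (x : n → 𝕜) : (M + N) *ᵥ x = 0 ↔ M *ᵥ x = 0 ∧ N *ᵥ x = 0 := by
  rw [← (hM.add hN).dotProduct_mulVec_zero_iff, ← hM.dotProduct_mulVec_zero_iff,
    ← hN.dotProduct_mulVec_zero_iff, add_mulVec, dotProduct_add]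
  exact add_eq_zero_iff_of_nonneg (hM.dotProduct_mulVec_nonneg x) (hN.dotProduct_mulVec_nonneg x)

theorem rank_add_mul_conjTranspose_self {E : Matrix n n 𝕜} (hE : E.PosSemidef)
    (B : Matrix n m 𝕜) : (E + B * Bᴴ).rank = (fromCols E B).rank := by
  rw [← rank_conjTranspose (fromCols E B), conjTranspose_fromCols_eq_fromRows_conjTranspose,
    hE.isHermitian.eq]
  refine rank_eq_of_mulVec_eq_zero_iff fun x => ?_
  rw [add_mulVec_eq_zero_iff_of_posSemidef hE (posSemidef_self_mul_conjTranspose B),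
    self_mul_conjTranspose_mulVec_eq_zero, fromRows_mulVec, ← Sum.elim_zero_zero, Sum.elim_eq_iff]

theorem range_mulVecLin_le_range_add_mul_conjTranspose {E : Matrix n n 𝕜} (hE : E.PosSemidef)
    (B : Matrix n m 𝕜) :
    LinearMap.range B.mulVecLin ≤ LinearMap.range (E + B * Bᴴ).mulVecLin := by
  rw [Submodule.eq_of_le_of_finrank_eq (range_mulVecLin_add_mul_le E B Bᴴ)
    (rank_add_mul_conjTranspose_self hE B), range_mulVecLin_fromCols]
  exact le_sup_right

theorem exists_posSemidef_add_mul_mul_conjTranspose_rank {E : Matrix n n 𝕜} (hE : E.PosSemidef)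
    (B : Matrix n m 𝕜) {k : ℕ} (hk : k ≤ B.rank) :
    ∃ F : Matrix m m 𝕜, (E + B * F * Bᴴ).PosSemidef ∧
      (E + B * F * Bᴴ).rank + k = (fromCols E B).rank := by
  classical
  set S := E + B * Bᴴ with hS_def
  have hS : S.PosSemidef := hE.add (posSemidef_self_mul_conjTranspose B)
  obtain ⟨W, hW⟩ := exists_mulVec_mul_injective_of_le_rank hk
  obtain ⟨T, hT⟩ := exists_mul_eq_of_range_mulVecLin_le
    (range_mulVecLin_le_range_add_mul_conjTranspose hE B)
  have hSU : S * (T * W) = B * W := by rw [← Matrix.mul_assoc, hT]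
  set U := T * W
  have hG : (Uᴴ * S * U).PosDef := posDef_conjTranspose_mul_mul_of_injective hS (hSU ▸ hW)
  have hUS : Uᴴ * S = Wᴴ * Bᴴ := by
    rw [← conjTranspose_mul, ← hSU, conjTranspose_mul S, hS.isHermitian.eq]
  have hF : E + B * (1 - W * (Uᴴ * S * U)⁻¹ * Wᴴ) * Bᴴ =
      S - S * U * (Uᴴ * S * U)⁻¹ * Uᴴ * S := by
    rw [Matrix.mul_assoc _ Uᴴ, hUS, hSU, hS_def]
    simp only [Matrix.mul_sub, Matrix.sub_mul, Matrix.mul_one, Matrix.mul_assoc, add_sub_assoc]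
  refine ⟨_, hF ▸ posSemidef_sub_mul_inv_mul hS hG, ?_⟩
  rw [hF, ← rank_add_mul_conjTranspose_self hE, ← hS_def,
    ← rank_sub_mul_inv_mul_add_card S ((isUnit_iff_isUnit_det _).1 hG.isUnit), Fintype.card_fin]

theorem re_dotProduct_mulVec_eq_zero_of_skew {T : Matrix n n 𝕜} (hT : T = -Tᴴ) (x : n → 𝕜) :
    RCLike.re (star x ⬝ᵥ T *ᵥ x) = 0 := by
  have hconj : star (star x ⬝ᵥ T *ᵥ x) = -(star x ⬝ᵥ T *ᵥ x) := by
    conv_rhs => rw [hT]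
    rw [← star_dotProduct, star_mulVec, neg_mulVec, dotProduct_neg, neg_neg, ← dotProduct_mulVec]
  have := congrArg RCLike.re hconj
  simp only [RCLike.star_def, RCLike.conj_re, map_neg] at this
  linarith

end PosSemidef

section Feedback

variable {n m : ℕ} {E A : Matrix (Fin n) (Fin n) ℂ} {B : Matrix (Fin n) (Fin m) ℂ}
  {C : Matrix (Fin m) (Fin n) ℂ}

theorem isImpulseFree_iff : IsImpulseFree E A ↔
    ∀ x, E *ᵥ x = 0 → A *ᵥ x ∈ LinearMap.range E.mulVecLin → x = 0 :=
  degree_det_pencil_eq_rank_iff E A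

theorem blockRankCondition_iff : BlockRankCondition E A B C ↔
    ∀ x, E *ᵥ x = 0 → C *ᵥ x = 0 → A *ᵥ x ∈ LinearMap.range (fromCols E B).mulVecLin → x = 0 := by
  set N : Matrix (Fin n ⊕ Fin n ⊕ Fin m) (Fin n ⊕ Fin m) ℂ :=
    fromRows 0 (fromRows (fromCols E B) 0) with hN
  have hN_mulVec (z : Fin n ⊕ Fin m → ℂ) :
      N *ᵥ z = Sum.elim (0 : Fin n → ℂ) (Sum.elim (fromCols E B *ᵥ z) (0 : Fin m → ℂ)) := by
    rw [hN, fromRows_mulVec, fromRows_mulVec, zero_mulVec, zero_mulVec]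
  have hN_rank : N.rank = (fromCols E B).rank := rank_eq_of_mulVec_eq_zero_iff fun z => by
    rw [hN_mulVec, ← Sum.elim_zero_zero, ← Sum.elim_zero_zero]
    simp only [Sum.elim_eq_iff, true_and, and_true]
  have hblock : BlockRankCondition E A B C ↔
      (fromCols (fromRows E (fromRows A C)) N).rank = n + (fromCols E B).rank := by
    rw [BlockRankCondition]
    congr! 2
    ext (i | i | i) (j | j | j) <;> rfl
  have hcols := rank_fromCols_eq_card_add_iff (fromRows E (fromRows A C)) N
  rw [hN_rank, Fintype.card_fin] at hcols
  refine hblock.trans (hcols.trans (forall_congr' fun x => ?_))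
  simp only [LinearMap.mem_range, mulVecLin_apply, hN_mulVec, fromRows_mulVec, Sum.elim_eq_iff,
    exists_and_left, exists_and_right, and_imp]
  exact ⟨fun h hE hC hA => h hE.symm hA hC.symm, fun h hE hA hC => h hE.symm hC.symm hA⟩

theorem IsAsymptoticallyStable.isRegular (h : IsAsymptoticallyStable E A) : IsRegular E A :=
  ⟨0, fun h0 => (h 0 h0).false⟩

theorem blockRankCondition_of_feedback {K F : Matrix (Fin m) (Fin m) ℂ}
    (hrank : (E + B * F * C).rank = (fromCols E B).rank)
    (h : IsImpulseFree (E + B * F * C) (A - B * K * C)) : BlockRankCondition E A B C := by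
  have hrange : LinearMap.range (E + B * F * C).mulVecLin =
      LinearMap.range (fromCols E B).mulVecLin := by
    rw [Matrix.mul_assoc] at hrank ⊢
    exact Submodule.eq_of_le_of_finrank_eq (range_mulVecLin_add_mul_le _ _ _) hrank
  rw [isImpulseFree_iff, hrange] at h
  refine blockRankCondition_iff.2 fun x hE hC hA => h x ?_ ?_
  · rw [add_mulVec, hE, mul_mulVec_eq_zero _ hC, add_zero]
  · rwa [sub_mulVec, mul_mulVec_eq_zero _ hC, sub_zero]

theorem imaginaryAxisRankCondition_of_feedback {K F : Matrix (Fin m) (Fin m) ℂ}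
    (h : IsAsymptoticallyStable (E + B * F * C) (A - B * K * C)) :
    ImaginaryAxisRankCondition E A B C := by
  intro s hs
  have hdet : (s • (E + B * F * C) - (A - B * K * C)).det ≠ 0 := fun h0 => (h s h0).ne hs
  have hpencil : s • (E + B * F * C) - (A - B * K * C) =
      s • E - A + B * (s • F + K) * C := by
    simp only [Matrix.mul_add, Matrix.add_mul, Matrix.mul_smul, Matrix.smul_mul, smul_add]
    abel
  rw [hpencil] at hdet
  constructor
  · rw [Matrix.mul_assoc] at hdet
    rw [rank_fromCols_eq_card_of_det_add_mul_ne_zero _ hdet, Fintype.card_fin]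
  · rw [rank_fromRows_eq_card_of_det_add_mul_ne_zero _ hdet, Fintype.card_fin]

theorem ImaginaryAxisRankCondition.eq_zero (h : ImaginaryAxisRankCondition E A B C) {s : ℂ}
    (hs : s.re = 0) {x : Fin n → ℂ} (hx : (s • E - A) *ᵥ x = 0) (hC : C *ᵥ x = 0) : x = 0 := by
  refine (rank_eq_card_iff_mulVec_eq_zero _).1 ((h s hs).2.trans (Fintype.card_fin n).symm) x ?_
  rw [fromRows_mulVec, hx, hC, Sum.elim_zero_zero]

end Feedback

section PortHamiltonian

variable {n m : ℕ} {Q E A : Matrix (Fin n) (Fin n) ℂ} {B : Matrix (Fin n) (Fin m) ℂ}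
  {C : Matrix (Fin m) (Fin n) ℂ}

theorem IsPortHamiltonianWith.output_eq (h : IsPortHamiltonianWith Q E A B C) : C = Bᴴ * Q := by
  obtain ⟨J, R, G, P, -, rfl, rfl, -, -, -, -, hP⟩ := h
  have hPQ : Pᴴ * Q = 0 := by
    rw [← conjTranspose_conjTranspose Q, ← conjTranspose_mul, hP, conjTranspose_zero]
  rw [conjTranspose_add, conjTranspose_sub, Matrix.add_mul, Matrix.sub_mul, hPQ, add_zero, sub_zero]

theorem IsPortHamiltonianWith.conjTranspose_mul_input (h : IsPortHamiltonianWith Q E A B C) :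
    Qᴴ * B = Cᴴ := by
  rw [h.output_eq, conjTranspose_mul, conjTranspose_conjTranspose]

theorem IsPortHamiltonianWith.det_conjTranspose_ne_zero (h : IsPortHamiltonianWith Q E A B C)
    (himag : ImaginaryAxisRankCondition E A B C) : Qᴴ.det ≠ 0 := by
  rw [det_conjTranspose, star_ne_zero]
  intro hdet
  obtain ⟨x, hx0, hx⟩ := exists_mulVec_eq_zero_iff.2 hdet
  have hC : C *ᵥ x = 0 := by rw [h.output_eq, ← mulVec_mulVec, hx, mulVec_zero]
  obtain ⟨J, R, -, -, hA, -⟩ := h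
  refine hx0 (himag.eq_zero Complex.zero_re ?_ hC)
  rw [zero_smul, zero_sub, neg_mulVec, hA, ← mulVec_mulVec, hx, mulVec_zero, neg_zero]

theorem IsPortHamiltonianWith.re_dotProduct_mulVec_nonpos (h : IsPortHamiltonianWith Q E A B C)
    (x : Fin n → ℂ) : (star x ⬝ᵥ (Qᴴ * A) *ᵥ x).re ≤ 0 := by
  obtain ⟨J, R, -, -, hA, -, -, -, -, hJ, hR, -⟩ := h
  have hQA : Qᴴ * A = Qᴴ * J * Q - Qᴴ * R * Q := by
    rw [hA, ← Matrix.mul_assoc, Matrix.mul_sub, Matrix.sub_mul]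
  have hskew := re_dotProduct_mulVec_eq_zero_of_skew hJ x
  have hnonneg := hR.re_dotProduct_nonneg x
  rw [RCLike.re_eq_complex_re] at hskew hnonneg
  rw [hQA, sub_mulVec, dotProduct_sub, Complex.sub_re, hskew]
  linarith

theorem IsPortHamiltonianWith.closedLoop (h : IsPortHamiltonianWith Q E A B C)
    {K : Matrix (Fin m) (Fin m) ℂ} (hK : K.PosSemidef) {E' : Matrix (Fin n) (Fin n) ℂ}
    (hE' : (Qᴴ * E').PosSemidef) : IsPortHamiltonianWith Q E' (A - B * K * C) B C := by
  have hC := h.output_eq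
  obtain ⟨J, R, G, P, hA, hB, hGP, -, -, hJ, hR, hP⟩ := h
  refine ⟨J, R + B * K * Bᴴ, G, P, ?_, hB, hGP, ?_, hE', hJ, ?_, hP⟩
  · rw [hA, hC, ← sub_sub, Matrix.sub_mul _ (B * K * Bᴴ), Matrix.mul_assoc (B * K)]
  · rw [← hE'.isHermitian.eq, conjTranspose_mul, conjTranspose_conjTranspose]
  · have hdiss : Qᴴ * (R + B * K * Bᴴ) * Q = Qᴴ * R * Q + Cᴴ * K * C := by
      rw [hC, conjTranspose_mul, conjTranspose_conjTranspose]
      simp only [Matrix.mul_add, Matrix.add_mul, Matrix.mul_assoc]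
    rw [hdiss]
    exact hR.add (hK.conjTranspose_mul_mul_same C)

theorem IsPortHamiltonianWith.output_mulVec_eq_zero (h : IsPortHamiltonianWith Q E A B C)
    {K : Matrix (Fin m) (Fin m) ℂ} (hK : K.PosDef) {x : Fin n → ℂ}
    (hx : 0 ≤ (star x ⬝ᵥ (Qᴴ * (A - B * K * C)) *ᵥ x).re) : C *ᵥ x = 0 := by
  by_contra hCx
  have hbalance : star x ⬝ᵥ (Qᴴ * (A - B * K * C)) *ᵥ x =
      star x ⬝ᵥ (Qᴴ * A) *ᵥ x - star (C *ᵥ x) ⬝ᵥ K *ᵥ (C *ᵥ x) := by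
    rw [Matrix.mul_sub, ← Matrix.mul_assoc, ← Matrix.mul_assoc, h.conjTranspose_mul_input,
      sub_mulVec, dotProduct_sub, star_mulVec, ← dotProduct_mulVec, mulVec_mulVec, mulVec_mulVec]
  have hpos := (Complex.pos_iff.1 (hK.dotProduct_mulVec_pos hCx)).1
  rw [hbalance, Complex.sub_re] at hx
  linarith [h.re_dotProduct_mulVec_nonpos x]

theorem IsPortHamiltonianWith.closedLoop_isImpulseFree (h : IsPortHamiltonianWith Q E A B C)
    (hblock : BlockRankCondition E A B C) {K F : Matrix (Fin m) (Fin m) ℂ} (hK : K.PosDef)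
    (hE' : (Qᴴ * (E + B * F * C)).PosSemidef) :
    IsImpulseFree (E + B * F * C) (A - B * K * C) := by
  refine isImpulseFree_iff.2 fun x hx hAx => ?_
  obtain ⟨y, hy⟩ := hAx
  rw [mulVecLin_apply] at hy
  have henergy : star x ⬝ᵥ (Qᴴ * (A - B * K * C)) *ᵥ x = 0 := by
    rw [← mulVec_mulVec, ← hy, mulVec_mulVec, dotProduct_mulVec, ← hE'.isHermitian.eq,
      ← star_mulVec, ← mulVec_mulVec, hx, mulVec_zero, star_zero, zero_dotProduct]
  have hC := h.output_mulVec_eq_zero hK (by rw [henergy, Complex.zero_re])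
  refine blockRankCondition_iff.1 hblock x ?_ hC ?_
  · rwa [add_mulVec, mul_mulVec_eq_zero _ hC, add_zero] at hx
  · rw [sub_mulVec, mul_mulVec_eq_zero _ hC, sub_zero] at hy
    rw [← hy, Matrix.mul_assoc]
    exact range_mulVecLin_add_mul_le _ _ _ ⟨y, rfl⟩

theorem IsPortHamiltonianWith.closedLoop_isAsymptoticallyStable
    (h : IsPortHamiltonianWith Q E A B C) (himag : ImaginaryAxisRankCondition E A B C)
    {K F : Matrix (Fin m) (Fin m) ℂ} (hK : K.PosDef) (hE' : (Qᴴ * (E + B * F * C)).PosSemidef) :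
    IsAsymptoticallyStable (E + B * F * C) (A - B * K * C) := by
  intro s hs
  by_contra! hre
  obtain ⟨x, hx0, hx⟩ := exists_mulVec_eq_zero_iff.2 hs
  rw [sub_mulVec, smul_mulVec, sub_eq_zero] at hx
  obtain ⟨henergy, him⟩ := Complex.nonneg_iff.1 (hE'.dotProduct_mulVec_nonneg x)
  have hpower : (star x ⬝ᵥ (Qᴴ * (A - B * K * C)) *ᵥ x).re =
      s.re * (star x ⬝ᵥ (Qᴴ * (E + B * F * C)) *ᵥ x).re := by
    rw [← mulVec_mulVec, ← hx, mulVec_smul, dotProduct_smul, smul_eq_mul, Complex.mul_re,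
      mulVec_mulVec, ← him, mul_zero, sub_zero]
  have hC : C *ᵥ x = 0 := h.output_mulVec_eq_zero hK (hpower ▸ mul_nonneg hre henergy)
  have hE'x : (E + B * F * C) *ᵥ x = E *ᵥ x := by
    rw [add_mulVec, mul_mulVec_eq_zero _ hC, add_zero]
  have hsE : s • E *ᵥ x = A *ᵥ x := by
    rwa [hE'x, sub_mulVec, mul_mulVec_eq_zero _ hC, sub_zero] at hx
  rcases hre.eq_or_lt with hs0 | hs0
  · refine hx0 (himag.eq_zero hs0.symm ?_ hC)
    rw [sub_mulVec, smul_mulVec, hsE, sub_self]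
  · have hnonpos := (h.closedLoop hK.posSemidef hE').re_dotProduct_mulVec_nonpos x
    have henergy_zero : star x ⬝ᵥ (Qᴴ * (E + B * F * C)) *ᵥ x = 0 :=
      Complex.ext (henergy.antisymm' (nonpos_of_mul_nonpos_right (hpower ▸ hnonpos) hs0)) him.symm
    have hQE := (hE'.dotProduct_mulVec_zero_iff x).1 henergy_zero
    rw [← mulVec_mulVec, hE'x] at hQE
    have hEx := eq_zero_of_mulVec_eq_zero (h.det_conjTranspose_ne_zero himag) hQE
    refine hx0 (himag.eq_zero Complex.zero_re ?_ hC)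
    rw [zero_smul, zero_sub, neg_mulVec, ← hsE, hEx, smul_zero, neg_zero]

theorem IsPortHamiltonianWith.exists_posSemidef_rank_add_eq (h : IsPortHamiltonianWith Q E A B C)
    (hQ : Qᴴ.det ≠ 0) {k : ℕ} (hk : k ≤ B.rank) : ∃ F : Matrix (Fin m) (Fin m) ℂ,
      (Qᴴ * (E + B * F * C)).PosSemidef ∧ (E + B * F * C).rank + k = (fromCols E B).rank := by
  have hrank {l : Type} [Fintype l] (M : Matrix (Fin n) l ℂ) : (Qᴴ * M).rank = M.rank :=
    rank_mul_eq_right_of_det_ne_zero _ _ hQ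
  have hQE : (Qᴴ * E).PosSemidef := by
    obtain ⟨-, -, -, -, -, -, -, -, hQE, -⟩ := h
    exact hQE
  obtain ⟨F, hF, hF_rank⟩ :=
    exists_posSemidef_add_mul_mul_conjTranspose_rank hQE (Qᴴ * B) (hk.trans_eq (hrank B).symm)
  have hclosed : Qᴴ * E + Qᴴ * B * F * (Qᴴ * B)ᴴ = Qᴴ * (E + B * F * C) := by
    rw [h.conjTranspose_mul_input, conjTranspose_conjTranspose, ← h.conjTranspose_mul_input]
    simp only [Matrix.mul_add, Matrix.mul_assoc]
  rw [hclosed] at hF hF_rank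
  rw [hrank, ← mul_fromCols, hrank] at hF_rank
  exact ⟨F, hF, hF_rank⟩

theorem IsPortHamiltonianWith.exists_feedback (h : IsPortHamiltonianWith Q E A B C)
    (hblock : BlockRankCondition E A B C) (himag : ImaginaryAxisRankCondition E A B C) {r : ℤ}
    (hr_ge : ((fromCols E B).rank : ℤ) - B.rank ≤ r) (hr_le : r ≤ (fromCols E B).rank) :
    ∃ K F : Matrix (Fin m) (Fin m) ℂ,
      IsRegular (E + B * F * C) (A - B * K * C) ∧
      IsImpulseFree (E + B * F * C) (A - B * K * C) ∧
      IsAsymptoticallyStable (E + B * F * C) (A - B * K * C) ∧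
      ((E + B * F * C).rank : ℤ) = r ∧
      IsPortHamiltonianWith Q (E + B * F * C) (A - B * K * C) B C := by
  lift (fromCols E B).rank - r to ℕ using by omega with k hk
  obtain ⟨F, hF, hF_rank⟩ :=
    h.exists_posSemidef_rank_add_eq (h.det_conjTranspose_ne_zero himag) (k := k) (by omega)
  have hstable := h.closedLoop_isAsymptoticallyStable himag (F := F) PosDef.one hF
  exact ⟨1, F, hstable.isRegular, h.closedLoop_isImpulseFree hblock PosDef.one hF, hstable,
    by omega, h.closedLoop PosSemidef.one hF⟩

end PortHamiltonian

end PHDescriptor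

theorem mainTheorem4 {n m : ℕ} (E A : Matrix (Fin n) (Fin n) ℂ)
    (B : Matrix (Fin n) (Fin m) ℂ) (C : Matrix (Fin m) (Fin n) ℂ)
    (hpH : IsPortHamiltonian E A B C) :
    ((∀ r : ℤ, ((Matrix.fromCols E B).rank : ℤ) - (B.rank : ℤ) ≤ r →
        r ≤ ((Matrix.fromCols E B).rank : ℤ) →
        ∃ K F : Matrix (Fin m) (Fin m) ℂ,
          IsRegular (E + B * F * C) (A - B * K * C) ∧
          IsImpulseFree (E + B * F * C) (A - B * K * C) ∧
          IsAsymptoticallyStable (E + B * F * C) (A - B * K * C) ∧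
          ((E + B * F * C).rank : ℤ) = r ∧
          IsPortHamiltonian (E + B * F * C) (A - B * K * C) B C) ↔
      (BlockRankCondition E A B C ∧ ImaginaryAxisRankCondition E A B C)) ∧
    (∀ Q : Matrix (Fin n) (Fin n) ℂ, IsPortHamiltonianWith Q E A B C →
      ((∀ r : ℤ, ((Matrix.fromCols E B).rank : ℤ) - (B.rank : ℤ) ≤ r →
          r ≤ ((Matrix.fromCols E B).rank : ℤ) →
          ∃ K F : Matrix (Fin m) (Fin m) ℂ,
            IsRegular (E + B * F * C) (A - B * K * C) ∧
            IsImpulseFree (E + B * F * C) (A - B * K * C) ∧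
            IsAsymptoticallyStable (E + B * F * C) (A - B * K * C) ∧
            ((E + B * F * C).rank : ℤ) = r ∧
            IsPortHamiltonianWith Q (E + B * F * C) (A - B * K * C) B C) ↔
        (BlockRankCondition E A B C ∧ ImaginaryAxisRankCondition E A B C))) := by
  refine ⟨⟨fun h => ?_, fun ⟨hblock, himag⟩ r hr_ge hr_le => ?_⟩, fun Q hQ => ⟨fun h => ?_,
    fun ⟨hblock, himag⟩ r hr_ge hr_le => hQ.exists_feedback hblock himag hr_ge hr_le⟩⟩
  · obtain ⟨K, F, -, himpulse, hstable, hrank, -⟩ := h _ (by omega) le_rfl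
    exact ⟨blockRankCondition_of_feedback (Nat.cast_injective hrank) himpulse,
      imaginaryAxisRankCondition_of_feedback hstable⟩
  · obtain ⟨Q, hQ⟩ := hpH
    obtain ⟨K, F, hreg, himpulse, hstable, hrank, hclosed⟩ :=
      hQ.exists_feedback hblock himag hr_ge hr_le
    exact ⟨K, F, hreg, himpulse, hstable, hrank, Q, hclosed⟩
  · obtain ⟨K, F, -, himpulse, hstable, hrank, -⟩ := h _ (by omega) le_rfl
    exact ⟨blockRankCondition_of_feedback (Nat.cast_injective hrank) himpulse,
      imaginaryAxisRankCondition_of_feedback hstable⟩
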